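/- A lattice polygon is a two-dimensional convex polygon $P\subset\mathbb{R}^2$ all of whose vertices lie in $\mathbb{Z}^2$. A vertex $v$ of $P$ is called quasi-smooth if it is at lattice distance one from the line through $v^-$ and $v^+$, where $v^-$ and $v^+$ are the lattice points immediately before and after $v$ along the boundary of $P$; here the lattice distance from a point $x_0$ to a line $\{x : u\cdot x=b\}$ with $u\in\mathbb{Z}^2$ primitive is $|b-u\cdot x_0|$. The polygon $P$ is called quasi-smooth if all of its vertices are quasi-smooth. The Ewald set of $P$ is $\mathcal{E}(P)=\mathbb{Z}^2\cap P\cap(-P)$. If $P\subset\mathbb{R}^2$ is a quasi-smooth lattice polygon with the origin in its interior, then $\mathcal{E}(P)$ contains a lattice basis, that is, two vectors forming a $\mathbb{Z}$-basis of $\mathbb{Z}^2$. -/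

import Mathlib

/-- The point of `ℝ^n` with the given integer coordinates. -/
def intPoint {n : ℕ} (z : Fin n → ℤ) : Fin n → ℝ := fun i => (z i : ℝ)

/-- The integer lattice `ℤ^n` inside `ℝ^n`. -/
def integerLattice (n : ℕ) : Set (Fin n → ℝ) := Set.range (intPoint (n := n))

/-- The Ewald set `ℤ^n ∩ P ∩ -P` of `P ⊆ ℝ^n`. -/
def ewaldSet {n : ℕ} (P : Set (Fin n → ℝ)) : Set (Fin n → ℝ) :=
  {x | x ∈ integerLattice n ∧ x ∈ P ∧ -x ∈ P}

/-- An integer vector is primitive if the only common divisors of its coordinates are `1`, `-1`.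
The zero vector is not primitive. -/
def IsPrimitiveVector {n : ℕ} (u : Fin n → ℤ) : Prop :=
  ∀ d : ℤ, (∀ i, d ∣ u i) → IsUnit d

/-- `H` is a hyperplane `{x | u ⬝ x = b}` with `u` an integer primitive vector, and `d` is the
lattice distance `|b - u ⬝ x₀|` from the point `x₀` to `H`. -/
def HasLatticeDistance {n : ℕ} (x₀ : Fin n → ℝ) (H : Set (Fin n → ℝ)) (d : ℝ) : Prop :=
  ∃ (u : Fin n → ℤ) (b : ℝ), IsPrimitiveVector u ∧
    H = {x | intPoint u ⬝ᵥ x = b} ∧ |b - intPoint u ⬝ᵥ x₀| = d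

/-- A lattice polygon: a two-dimensional convex polygon in the plane that is the convex hull of
finitely many lattice points. -/
def IsLatticePolygon (P : Set (Fin 2 → ℝ)) : Prop :=
  (∃ S : Set (Fin 2 → ℝ), S.Finite ∧ S ⊆ integerLattice 2 ∧ P = convexHull ℝ S) ∧
    (interior P).Nonempty

/-- The lattice point `w` is next to the lattice point `v` along the boundary of `P`: it is joined
to `v` by a segment in the boundary of `P` whose only lattice points are its two ends. For a
vertex `v` of a lattice polygon there are exactly two such `w`, one on each edge at `v`. -/
def IsNextAlongBoundary (P : Set (Fin 2 → ℝ)) (v w : Fin 2 → ℝ) : Prop :=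
  v ∈ integerLattice 2 ∧ w ∈ integerLattice 2 ∧ w ≠ v ∧ segment ℝ v w ⊆ frontier P ∧
    Disjoint (openSegment ℝ v w) (integerLattice 2)

/-- A vertex `v` is quasi-smooth if it is at lattice distance one from the line through the two
lattice points next to it along the boundary of `P`. -/
def IsQuasiSmoothAt (P : Set (Fin 2 → ℝ)) (v : Fin 2 → ℝ) : Prop :=
  ∃ w₁ w₂ : Fin 2 → ℝ, w₁ ≠ w₂ ∧ IsNextAlongBoundary P v w₁ ∧ IsNextAlongBoundary P v w₂ ∧
    HasLatticeDistance v (affineSpan ℝ {w₁, w₂} : Set (Fin 2 → ℝ)) 1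

/-- A polygon is quasi-smooth if all its vertices are. -/
def IsQuasiSmooth (P : Set (Fin 2 → ℝ)) : Prop :=
  ∀ v ∈ P.extremePoints ℝ, IsQuasiSmoothAt P v

/-! The Ewald set is convex and centrally symmetric, and everything takes place in the finite set `L`
of lattice points of `P`, up to unimodular changes of coordinates (`IsQuasiSmoothPointSet`).

The key is a row inequality (`IsQuasiSmoothPointSet.exists_add_nonneg`): if `(1, 0) ∈ L`, and if
`(b, 1)` and `(B, -1)` are the rightmost lattice points of `P` in their rows, then `0 ≤ b + B`.
Suppose `b + B ≤ -1`. By convexity a point `(x, y)` of `L` has `x ≤ b y` if `0 < y` and `x ≤ -B y`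
if `y < 0`, so `x - b y` attains its maximum over `L` only at the rightmost point `(t, 0)` of the row
`y = 0`, where it is positive. Hence `(t, 0)` is a vertex. Let `(α, p)` and `(β, q)`, with
`q < 0 < p`, be the primitive vectors along its edges. Quasi-smoothness gives an integer functional
with the value `1` on both, so `β p - α q` divides the positive number `p - q`; but the bounds
`t + α ≤ b p` and `t + β ≤ -B q` give `α (-q) + β p ≤ (b + B) p (-q) - t (p - q) < -(p - q)`.

If `(1, 0)` and `(-1, 0)` both lie in `L`, then the row inequality for `L` and for `-L` says that the
rows `y = 1` of `L` and of `-L` are overlapping intervals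
(`IsQuasiSmoothPointSet.exists_mem_row_one_and_neg_mem`); a common point `(c, 1)` together with
`(1, 0)` is the desired basis. It remains to find two antiparallel points of `L`
(`IsQuasiSmoothPointSet.exists_antiparallel`). If there are none, then a smallest triangle with
vertices in `L` and the origin in its interior is `p`, `q`, `-(p + q)` with `p`, `q` a basis, and the
row inequality in this basis shows that `p + q` or `-q` lies in `L` after all. -/

/-! ### Quasi-smooth point sets and unimodular coordinates -/

/-- The determinant of two integer vectors in the plane. -/
def planeDet (p q : ℤ × ℤ) : ℤ := p.1 * q.2 - p.2 * q.1

/-- What the argument uses of the set `L` of lattice points of a quasi-smooth polygon with the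
origin in its interior: `L` is finite, contains the origin and every lattice point that is a
rational convex combination of three of its points, lies in no closed half-plane through the
origin, and is quasi-smooth at its vertices. A vertex is encoded as a point `v` where some integer
linear functional attains its strict maximum over `L`; there, `e` and `e'` are the primitive
vectors along the two edges, in counterclockwise order, and `u` takes the value `1` on both, which
says that `v` has lattice distance one from the line through `v + e` and `v + e'`. -/
structure IsQuasiSmoothPointSet (L : Set (ℤ × ℤ)) : Prop where
  finite : L.Finite
  zero_mem : (0, 0) ∈ L
  convex : ∀ {p q r z : ℤ × ℤ} (i j k : ℤ), p ∈ L → q ∈ L → r ∈ L → 0 ≤ i → 0 ≤ j → 0 ≤ k →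
    0 < i + j + k → (i + j + k) * z.1 = i * p.1 + j * q.1 + k * r.1 →
    (i + j + k) * z.2 = i * p.2 + j * q.2 + k * r.2 → z ∈ L
  exists_pos : ∀ a b : ℤ, (a ≠ 0 ∨ b ≠ 0) → ∃ z ∈ L, 0 < a * z.1 + b * z.2
  vertex : ∀ (a b : ℤ), ∀ v ∈ L, (∀ z ∈ L, z ≠ v → a * z.1 + b * z.2 < a * v.1 + b * v.2) →
    ∃ e e' u : ℤ × ℤ, v + e ∈ L ∧ v + e' ∈ L ∧
      u.1 * e.1 + u.2 * e.2 = 1 ∧ u.1 * e'.1 + u.2 * e'.2 = 1 ∧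
      ∀ z ∈ L, 0 ≤ planeDet e (z - v) ∧ 0 ≤ planeDet (z - v) e'

/-- The set of coordinate vectors of the points of `L` in the basis `p`, `q`. -/
def coordSet (L : Set (ℤ × ℤ)) (p q : ℤ × ℤ) : Set (ℤ × ℤ) :=
  {z : ℤ × ℤ | (z.1 * p.1 + z.2 * q.1, z.1 * p.2 + z.2 * q.2) ∈ L}

namespace IsQuasiSmoothPointSet

variable {L : Set (ℤ × ℤ)}

theorem mem_coordSet_of_mem {p q z : ℤ × ℤ} (hpq : planeDet p q = 1)
    (hz : z ∈ L) : (planeDet z q, planeDet p z) ∈ coordSet L p q := by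
  unfold planeDet at *
  have h : ((z.1 * q.2 - z.2 * q.1) * p.1 + (p.1 * z.2 - p.2 * z.1) * q.1,
      (z.1 * q.2 - z.2 * q.1) * p.2 + (p.1 * z.2 - p.2 * z.1) * q.2) = z := by
    ext
    · linear_combination z.1 * hpq
    · linear_combination z.2 * hpq
  simpa [coordSet, h] using hz

/-- The defining properties do not depend on the oriented basis of the lattice. -/
theorem inBasis (h : IsQuasiSmoothPointSet L) {p q : ℤ × ℤ} (hpq : planeDet p q = 1) :
    IsQuasiSmoothPointSet (coordSet L p q) where
  finite := by
    refine h.finite.preimage (f := fun z : ℤ × ℤ => (z.1 * p.1 + z.2 * q.1, z.1 * p.2 + z.2 * q.2)) ?_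
    rintro ⟨x, y⟩ - ⟨x', y'⟩ - hxy
    simp only [Prod.mk.injEq] at hxy
    obtain ⟨h₁, h₂⟩ := hxy
    unfold planeDet at hpq
    ext
    · show x = x'
      linear_combination q.2 * h₁ - q.1 * h₂ - (x - x') * hpq
    · show y = y'
      linear_combination p.1 * h₂ - p.2 * h₁ - (y - y') * hpq
  zero_mem := by simpa [coordSet] using h.zero_mem
  convex := by
    intro a b c z i j k ha hb hc hi hj hk hs h₁ h₂
    refine h.convex i j k ha hb hc hi hj hk hs ?_ ?_
    · linear_combination p.1 * h₁ + q.1 * h₂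
    · linear_combination p.2 * h₁ + q.2 * h₂
  exists_pos := by
    intro a b hab
    have hne : a * q.2 - b * p.2 ≠ 0 ∨ b * p.1 - a * q.1 ≠ 0 := by
      by_contra! hcon
      unfold planeDet at hpq
      have ha : a = 0 := by linear_combination p.1 * hcon.1 + p.2 * hcon.2 - a * hpq
      have hb : b = 0 := by linear_combination q.1 * hcon.1 + q.2 * hcon.2 - b * hpq
      simp_all
    obtain ⟨z, hz, hpos⟩ := h.exists_pos _ _ hne
    refine ⟨_, mem_coordSet_of_mem hpq hz, ?_⟩
    simp only [planeDet]
    linarith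
  vertex := by
    intro a b v hv hmax
    obtain ⟨e, e', u, he, he', hu, hu', hcone⟩ :=
      h.vertex (a * q.2 - b * p.2) (b * p.1 - a * q.1) _ hv (by
        intro z hz hne
        have hlt := hmax _ (mem_coordSet_of_mem hpq hz) (by
          rintro rfl
          apply hne
          unfold planeDet at *
          ext
          · linear_combination -z.1 * hpq
          · linear_combination -z.2 * hpq)
        simp only [planeDet] at *
        have h₁ : (a * q.2 - b * p.2) * (v.1 * p.1 + v.2 * q.1) +
            (b * p.1 - a * q.1) * (v.1 * p.2 + v.2 * q.2) = a * v.1 + b * v.2 := by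
          linear_combination (a * v.1 + b * v.2) * hpq
        rw [h₁]
        linarith)
    refine ⟨(planeDet e q, planeDet p e), (planeDet e' q, planeDet p e'),
      (u.1 * p.1 + u.2 * p.2, u.1 * q.1 + u.2 * q.2), ?_, ?_, ?_, ?_, ?_⟩
    · have := mem_coordSet_of_mem hpq he
      convert this using 1
      unfold planeDet at *
      ext
      · simp only [Prod.fst_add, Prod.snd_add]
        linear_combination -v.1 * hpq
      · simp only [Prod.fst_add, Prod.snd_add]
        linear_combination -v.2 * hpq
    · have := mem_coordSet_of_mem hpq he'
      convert this using 1
      unfold planeDet at *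
      ext
      · simp only [Prod.fst_add, Prod.snd_add]
        linear_combination -v.1 * hpq
      · simp only [Prod.fst_add, Prod.snd_add]
        linear_combination -v.2 * hpq
    · unfold planeDet at *
      linear_combination hu + (u.1 * e.1 + u.2 * e.2) * hpq
    · unfold planeDet at *
      linear_combination hu' + (u.1 * e'.1 + u.2 * e'.2) * hpq
    · intro z hz
      have := hcone _ hz
      unfold planeDet at *
      simp only [Prod.fst_sub, Prod.snd_sub] at *
      constructor
      · linarith [this.1]
      · linarith [this.2]

/-! ### The row inequality -/

/-- A point of `L` above the `x`-axis lies weakly left of the line through the origin and the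
last point `(b, 1)` of that row, provided that `(1, 0) ∈ L`: otherwise the triangle with vertices
`(1, 0)`, `(b, 1)` and that point contains `(b + 1, 1)`. -/
theorem fst_le_of_row_max (h : IsQuasiSmoothPointSet L) (h₁ : (1, 0) ∈ L) {b x y : ℤ}
    (hb : (b, 1) ∈ L) (hb' : (b + 1, 1) ∉ L) (hy : 0 < y) (hxy : (x, y) ∈ L) : x ≤ b * y := by
  by_contra! hlt
  refine hb' (h.convex (x - 1 - b * y) (y - 1) 1 hb h₁ hxy ?_ ?_ ?_ ?_ ?_ ?_)
  · linarith
  · linarith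
  · norm_num
  · linarith
  · ring
  · ring

theorem neg (h : IsQuasiSmoothPointSet L) : IsQuasiSmoothPointSet (-L) := by
  convert h.inBasis (p := (-1, 0)) (q := (0, -1)) (by norm_num [planeDet]) using 1
  ext ⟨x, y⟩
  simp [coordSet]

theorem fst_le_of_neg_row_max (h : IsQuasiSmoothPointSet L) (h₁ : (1, 0) ∈ L) {b x y : ℤ}
    (hb : (b, -1) ∈ L) (hb' : (b + 1, -1) ∉ L) (hy : y < 0) (hxy : (x, y) ∈ L) :
    x ≤ b * (-y) := by
  by_contra! hlt
  refine hb' (h.convex (x - 1 + b * y) (-y - 1) 1 hb h₁ hxy ?_ ?_ ?_ ?_ ?_ ?_)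
  · linarith
  · linarith
  · norm_num
  · linarith
  · ring
  · ring

theorem exists_row_max (h : IsQuasiSmoothPointSet L) {x y : ℤ} (hx : (x, y) ∈ L) :
    ∃ b, (b, y) ∈ L ∧ ∀ c, (c, y) ∈ L → c ≤ b := by
  have hfin : {c : ℤ | (c, y) ∈ L}.Finite :=
    h.finite.preimage (f := fun c : ℤ => (c, y)) (fun a _ b _ hab => by simpa using hab)
  obtain ⟨b, hb, hmax⟩ := hfin.exists_maximal ⟨x, hx⟩
  refine ⟨b, hb, fun c hc => ?_⟩
  by_contra! hlt
  exact absurd (hmax hc hlt.le) (not_le.mpr hlt)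

/-- The heart of the proof: for `(1, 0) ∈ L`, the right ends `(b, 1)` and `(B, -1)` of the rows
`y = 1` and `y = -1` satisfy `0 ≤ b + B`. -/
theorem exists_add_nonneg (h : IsQuasiSmoothPointSet L) (h₁ : (1, 0) ∈ L) {x x' : ℤ}
    (hx : (x, 1) ∈ L) (hx' : (x', -1) ∈ L) : ∃ b B, (b, 1) ∈ L ∧ (B, -1) ∈ L ∧ 0 ≤ b + B := by
  obtain ⟨b, hb, hbmax⟩ := h.exists_row_max hx
  obtain ⟨B, hB, hBmax⟩ := h.exists_row_max hx'
  refine ⟨b, B, hb, hB, ?_⟩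
  by_contra! hneg
  obtain ⟨t, ht, htmax⟩ := h.exists_row_max h₁
  have ht1 : 1 ≤ t := htmax 1 h₁
  have hup : ∀ x y : ℤ, 0 < y → (x, y) ∈ L → x ≤ b * y := fun x y hy hxy =>
    h.fst_le_of_row_max h₁ hb (fun hc => by linarith [hbmax _ hc]) hy hxy
  have hdown : ∀ x y : ℤ, y < 0 → (x, y) ∈ L → x ≤ B * (-y) := fun x y hy hxy =>
    h.fst_le_of_neg_row_max h₁ hB (fun hc => by linarith [hBmax _ hc]) hy hxy
  -- The functional `x - b y` is nonpositive on `L` off the row `y = 0`, so `(t, 0)` is a vertex.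
  obtain ⟨⟨α, p⟩, ⟨β, q⟩, u, he, he', hu, hu', hcone⟩ := h.vertex 1 (-b) (t, 0) ht (by
    rintro ⟨x, y⟩ hz hne
    show 1 * x + -b * y < 1 * t + -b * 0
    rcases lt_trichotomy y 0 with hy | rfl | hy
    · nlinarith [hdown x y hy hz]
    · have hle := htmax x hz
      have : x ≠ t := by rintro rfl; exact hne rfl
      have := lt_of_le_of_ne hle this
      linarith
    · linarith [hup x y hy hz])
  simp only [planeDet, Prod.mk_add_mk, Prod.fst_sub, Prod.snd_sub, zero_add, sub_zero]
    at he he' hu hu' hcone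
  have h0 := hcone _ h.zero_mem
  simp only at h0
  -- One edge at `(t, 0)` goes strictly upwards and the other one strictly downwards.
  have hp : 0 < p := by
    have hp0 : 0 ≤ p := by nlinarith [h0.1]
    rcases hp0.lt_or_eq with hp | rfl
    · exact hp
    · have hα : α ≠ 0 := by rintro rfl; simp at hu
      obtain ⟨z, hz, hpos⟩ := h.exists_pos 0 (-α) (Or.inr (neg_ne_zero.mpr hα))
      linarith [(hcone z hz).1]
  have hq : q < 0 := by
    have hq0 : q ≤ 0 := by nlinarith [h0.2]
    rcases hq0.lt_or_eq with hq | rfl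
    · exact hq
    · have hβ : β ≠ 0 := by rintro rfl; simp at hu'
      obtain ⟨z, hz, hpos⟩ := h.exists_pos 0 β (Or.inr hβ)
      linarith [(hcone z hz).2]
  have hα := hup _ _ hp he
  have hβ := hdown _ _ hq he'
  -- The nonzero multiple `p - q` of `β * p - α * q` is smaller than it in absolute value.
  have hdvd : (β * p - α * q) ∣ p - q := ⟨u.1, by linear_combination q * hu - p * hu'⟩
  have hbig : p - q < -(β * p - α * q) := by
    have e₁ : α * (-q) ≤ (b * p - t) * (-q) := mul_le_mul_of_nonneg_right (by linarith) (by linarith)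
    have e₂ : β * p ≤ (B * (-q) - t) * p := mul_le_mul_of_nonneg_right (by linarith) hp.le
    have e₃ : 0 < p * (-q) := mul_pos hp (by linarith)
    have e₄ : (b + B) * (p * (-q)) ≤ -1 * (p * (-q)) :=
      mul_le_mul_of_nonneg_right (by linarith) e₃.le
    have e₅ : 1 * (p - q) ≤ t * (p - q) := mul_le_mul_of_nonneg_right ht1 (by linarith)
    linarith
  have := Int.le_of_dvd (by linarith) ((neg_dvd).mpr hdvd)
  linarith

theorem exists_mem_row_one (h : IsQuasiSmoothPointSet L) (h₁ : (-1, 0) ∈ L) : ∃ x, (x, 1) ∈ L := by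
  obtain ⟨⟨x, y⟩, hz, hpos⟩ := h.exists_pos 0 1 (by simp)
  have hy : 0 < y := by simpa using hpos
  have hm := Int.emod_nonneg x hy.ne'
  have hm' := Int.emod_lt_of_pos x hy
  have hdiv := Int.emod_add_mul_ediv x y
  refine ⟨x / y, h.convex 1 (x % y) (y - 1 - x % y) hz h₁ h.zero_mem ?_ hm ?_ ?_ ?_ ?_⟩
  · norm_num
  · linarith
  · linarith
  · linear_combination hdiv
  · ring

theorem mem_row_of_le (h : IsQuasiSmoothPointSet L) {a b c y : ℤ} (ha : (a, y) ∈ L)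
    (hb : (b, y) ∈ L) (hac : a ≤ c) (hcb : c ≤ b) : (c, y) ∈ L := by
  rcases hac.eq_or_lt with rfl | hlt
  · exact ha
  · refine h.convex (b - c) (c - a) 0 ha hb hb ?_ ?_ ?_ ?_ ?_ ?_
    · linarith
    · linarith
    · norm_num
    · linarith
    · ring
    · ring

/-- If `L` contains `(1, 0)` and `(-1, 0)`, then the row `y = 1` of `L` and that of `-L` meet. -/
theorem exists_mem_row_one_and_neg_mem (h : IsQuasiSmoothPointSet L) (h₁ : (1, 0) ∈ L)
    (h₂ : (-1, 0) ∈ L) : ∃ c, (c, 1) ∈ L ∧ (-c, -1) ∈ L := by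
  obtain ⟨x, hx⟩ := h.exists_mem_row_one h₂
  obtain ⟨x', hx'⟩ := h.neg.exists_mem_row_one (by simpa using h₁)
  obtain ⟨b, B, hb, hB, hbB⟩ := h.exists_add_nonneg h₁ hx (by simpa using hx')
  obtain ⟨A, a, hA, ha, haA⟩ := h.neg.exists_add_nonneg (by simpa using h₂) (x' := -x) hx'
    (by simpa using hx)
  replace hA : (-A, -1) ∈ L := by simpa using hA
  replace ha : (-a, 1) ∈ L := by simpa using ha
  rcases le_total (-a) (-B) with hle | hle
  · exact ⟨-B, h.mem_row_of_le ha hb hle (by linarith), by simpa using hB⟩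
  · rcases le_total (-a) b with hab | hab
    · exact ⟨-a, ha, h.mem_row_of_le hA hB (by linarith) (by linarith)⟩
    · exact ⟨b, hb, h.mem_row_of_le hA hB (by linarith) (by linarith)⟩

/-- Two antiparallel points of `L` yield a unimodular pair in `L ∩ -L`: a primitive vector `r` on
their line lies in `L ∩ -L`, and in a basis starting with `r` the rows `y = 1` of `L` and `-L`
meet. -/
theorem exists_unimodular_of_antiparallel (h : IsQuasiSmoothPointSet L) {p q : ℤ × ℤ} (hp : p ∈ L)
    (hq : q ∈ L) (hdet : planeDet p q = 0) (hdot : p.1 * q.1 + p.2 * q.2 < 0) :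
    ∃ r s, r ∈ L ∧ -r ∈ L ∧ s ∈ L ∧ -s ∈ L ∧ planeDet r s = 1 := by
  obtain ⟨p₁, p₂⟩ := p
  obtain ⟨q₁, q₂⟩ := q
  simp only [planeDet] at hdet hdot
  have hne : p₁ ≠ 0 ∨ p₂ ≠ 0 := by
    by_contra! hcon
    simp [hcon.1, hcon.2] at hdot
  have hg : 0 < Int.gcd p₁ p₂ := Int.gcd_pos_iff.mpr hne
  obtain ⟨r₁, r₂, hr, e₁, e₂⟩ := Int.exists_gcd_one hg
  set g : ℤ := (Int.gcd p₁ p₂ : ℤ) with hgdef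
  have hg0 : 0 < g := Int.natCast_pos.mpr hg
  obtain ⟨s, t, hst⟩ := Int.isCoprime_iff_gcd_eq_one.mpr hr
  have hd : r₁ * q₂ = r₂ * q₁ := by
    have : g * (r₁ * q₂ - r₂ * q₁) = 0 := by rw [e₁, e₂] at hdet; linear_combination hdet
    rcases mul_eq_zero.mp this with h0 | h0 <;> linarith
  -- `q` is an integer multiple of the primitive vector `r`.
  have hq₁ : q₁ = (s * q₁ + t * q₂) * r₁ := by linear_combination -q₁ * hst - t * hd
  have hq₂ : q₂ = (s * q₁ + t * q₂) * r₂ := by linear_combination -q₂ * hst + s * hd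
  set m := s * q₁ + t * q₂
  have hm : m < 0 := by
    by_contra! hm
    have : p₁ * q₁ + p₂ * q₂ = g * m * (r₁ ^ 2 + r₂ ^ 2) := by
      rw [e₁, e₂, hq₁, hq₂]; ring
    have : 0 ≤ g * m * (r₁ ^ 2 + r₂ ^ 2) := by positivity
    linarith
  have hrL : (r₁, r₂) ∈ L := by
    refine h.convex 1 (g - 1) 0 hp h.zero_mem hq ?_ ?_ ?_ ?_ ?_ ?_
    · norm_num
    · linarith
    · norm_num
    · linarith
    · linear_combination -e₁
    · linear_combination -e₂
  have hrL' : (-r₁, -r₂) ∈ L := by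
    refine h.convex 1 (-m - 1) 0 hq h.zero_mem hp ?_ ?_ ?_ ?_ ?_ ?_
    · norm_num
    · linarith
    · norm_num
    · linarith
    · linear_combination -hq₁
    · linear_combination -hq₂
  have hdet' : planeDet (r₁, r₂) (-t, s) = 1 := by
    simp only [planeDet]; linear_combination hst
  obtain ⟨c, hc, hc'⟩ := (h.inBasis hdet').exists_mem_row_one_and_neg_mem
    (by simpa [coordSet] using hrL) (by simpa [coordSet] using hrL')
  refine ⟨(r₁, r₂), (c * r₁ - t, c * r₂ + s), hrL, hrL', ?_, ?_, ?_⟩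
  · simpa [coordSet, sub_eq_add_neg] using hc
  · have hmem : (-c * r₁ + -1 * -t, -c * r₂ + -1 * s) ∈ L := hc'
    convert hmem using 1
    ext
    · show -(c * r₁ - t) = _
      ring
    · show -(c * r₂ + s) = _
      ring
  · simp only [planeDet]; linear_combination hst

/-! ### Triangles around the origin -/

/-- A positively oriented pair that is not unimodular leaves a nonzero lattice point
`(i • p + j • q) / det(p, q)` in the triangle with vertices `0`, `p`, `q`, other than `p`, `q`. -/
theorem exists_lattice_point_in_triangle {p q : ℤ × ℤ} (hd : 1 < planeDet p q) :
    ∃ r : ℤ × ℤ, ∃ i j : ℤ, 0 ≤ i ∧ 0 ≤ j ∧ i < planeDet p q ∧ j < planeDet p q ∧ 0 < i + j ∧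
      i + j ≤ planeDet p q ∧ planeDet p q * r.1 = i * p.1 + j * q.1 ∧
      planeDet p q * r.2 = i * p.2 + j * q.2 := by
  obtain ⟨p₁, p₂⟩ := p
  obtain ⟨q₁, q₂⟩ := q
  set d := planeDet (p₁, p₂) (q₁, q₂) with hddef
  have hdet : d = p₁ * q₂ - p₂ * q₁ := rfl
  -- A lattice point outside the lattice spanned by `p` and `q`.
  obtain ⟨x, y, hxy⟩ : ∃ x y : ℤ, ¬ (d ∣ x * q₂ - y * q₁ ∧ d ∣ p₁ * y - p₂ * x) := by
    by_contra! hcon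
    obtain ⟨⟨a, ha⟩, ⟨b, hb⟩⟩ := hcon 1 0
    obtain ⟨⟨a', ha'⟩, ⟨b', hb'⟩⟩ := hcon 0 1
    have h₁ : d * 1 = d * (d * (a * b' - a' * b)) := by
      have e₁ : q₂ = d * a := by linarith
      have e₂ : p₂ = -(d * b) := by linarith
      have e₃ : q₁ = -(d * a') := by linarith
      have e₄ : p₁ = d * b' := by linarith
      calc d * 1 = p₁ * q₂ - p₂ * q₁ := by rw [mul_one, hdet]
        _ = (d * b') * (d * a) - (-(d * b)) * (-(d * a')) := by
            rw [← e₁, ← e₂, ← e₃, ← e₄]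
        _ = _ := by ring
    have h₂ := mul_left_cancel₀ (by linarith) h₁
    have := Int.le_of_dvd one_pos ⟨_, h₂⟩
    linarith
  have hd0 : 0 < d := by linarith
  set A := x * q₂ - y * q₁ with hA
  set B := p₁ * y - p₂ * x with hB
  have hi := Int.emod_nonneg A hd0.ne'
  have hi' := Int.emod_lt_of_pos A hd0
  have hj := Int.emod_nonneg B hd0.ne'
  have hj' := Int.emod_lt_of_pos B hd0
  have hAd := Int.emod_add_mul_ediv A d
  have hBd := Int.emod_add_mul_ediv B d
  have hij : 0 < A % d + B % d := by
    by_contra! hle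
    exact hxy ⟨Int.dvd_of_emod_eq_zero (by linarith), Int.dvd_of_emod_eq_zero (by linarith)⟩
  have e₁ : d * (x - A / d * p₁ - B / d * q₁) = A % d * p₁ + B % d * q₁ := by
    linear_combination -p₁ * hAd - q₁ * hBd + p₁ * hA + q₁ * hB + x * hdet
  have e₂ : d * (y - A / d * p₂ - B / d * q₂) = A % d * p₂ + B % d * q₂ := by
    linear_combination -p₂ * hAd - q₂ * hBd + p₂ * hA + q₂ * hB + y * hdet
  rcases le_or_gt (A % d + B % d) d with hle | hgt
  · exact ⟨(x - A / d * p₁ - B / d * q₁, y - A / d * p₂ - B / d * q₂), A % d, B % d,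
      hi, hj, hi', hj', hij, hle, e₁, e₂⟩
  · -- Reflect the point in the centre of the parallelogram spanned by `p` and `q`.
    refine ⟨(p₁ + q₁ - (x - A / d * p₁ - B / d * q₁), p₂ + q₂ - (y - A / d * p₂ - B / d * q₂)),
      d - A % d, d - B % d, by linarith, by linarith, by linarith, by linarith, by linarith,
      by linarith, ?_, ?_⟩
    · linear_combination -e₁
    · linear_combination -e₂

/-- A triangle with the origin in its interior, vertices in `L`, and a nonunimodular side either
can be shrunk or exhibits two antiparallel points of `L`. -/
theorem exists_smaller_triangle (h : IsQuasiSmoothPointSet L) {p q s : ℤ × ℤ} (hp : p ∈ L)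
    (hq : q ∈ L) (hs : s ∈ L) (hpq : 1 < planeDet p q) (hqs : 0 < planeDet q s)
    (hsp : 0 < planeDet s p) :
    (∃ a ∈ L, ∃ b ∈ L, planeDet a b = 0 ∧ a.1 * b.1 + a.2 * b.2 < 0) ∨
    ∃ a ∈ L, ∃ b ∈ L, ∃ c ∈ L, 0 < planeDet a b ∧ 0 < planeDet b c ∧ 0 < planeDet c a ∧
      planeDet a b + planeDet b c + planeDet c a <
        planeDet p q + planeDet q s + planeDet s p := by
  obtain ⟨r, i, j, hi, hj, hid, hjd, hij, hijd, e₁, e₂⟩ := exists_lattice_point_in_triangle hpq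
  have hr : r ∈ L := by
    refine h.convex i j (planeDet p q - i - j) hp hq h.zero_mem hi hj ?_ ?_ ?_ ?_
    · linarith
    · linarith
    · linear_combination e₁
    · linear_combination e₂
  have hd0 : 0 < planeDet p q := by linarith
  -- The determinants of `r` with the vertices are read off from its barycentric coordinates.
  have hrq : planeDet r q = i := by
    refine mul_left_cancel₀ hd0.ne' ?_
    unfold planeDet at *
    linear_combination q.2 * e₁ - q.1 * e₂
  have hpr : planeDet p r = j := by
    refine mul_left_cancel₀ hd0.ne' ?_
    unfold planeDet at *
    linear_combination p.1 * e₂ - p.2 * e₁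
  have hrs : planeDet p q * planeDet r s = j * planeDet q s - i * planeDet s p := by
    unfold planeDet at *
    linear_combination s.2 * e₁ - s.1 * e₂
  have hneg : planeDet s r = -planeDet r s := by unfold planeDet; ring
  rcases lt_trichotomy (planeDet r s) 0 with hlt | heq | hgt
  · have hi0 : 0 < i := by
      by_contra! hle
      have : i = 0 := le_antisymm hle hi
      have h₁ := mul_neg_of_pos_of_neg hd0 hlt
      have h₂ := mul_nonneg hj hqs.le
      rw [hrs, this] at h₁
      linarith
    have hbound : -planeDet r s < planeDet s p := by
      refine lt_of_mul_lt_mul_left ?_ hd0.le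
      have h₁ := mul_lt_mul_of_pos_right hid hsp
      have h₂ := mul_nonneg hj hqs.le
      linarith
    exact Or.inr ⟨r, hr, q, hq, s, hs, by linarith, hqs, by linarith, by linarith⟩
  · have hk : j * planeDet q s = i * planeDet s p := by rw [heq] at hrs; linarith
    refine Or.inl ⟨r, hr, s, hs, heq, ?_⟩
    -- Here `r` is a positive multiple of `det(q, s) • p + det(s, p) • q = -det(p, q) • s`.
    have hi0 : 0 < i := by
      by_contra! hle
      have hi0 : i = 0 := le_antisymm hle hi
      have : 0 < j * planeDet q s := mul_pos (by linarith) hqs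
      rw [hk, hi0] at this
      linarith
    have f₁ : planeDet q s * r.1 = -i * s.1 := by
      refine mul_left_cancel₀ hd0.ne' ?_
      have : planeDet q s * p.1 + planeDet s p * q.1 + planeDet p q * s.1 = 0 := by
        unfold planeDet; ring
      linear_combination planeDet q s * e₁ + q.1 * hk + i * this
    have f₂ : planeDet q s * r.2 = -i * s.2 := by
      refine mul_left_cancel₀ hd0.ne' ?_
      have : planeDet q s * p.2 + planeDet s p * q.2 + planeDet p q * s.2 = 0 := by
        unfold planeDet; ring
      linear_combination planeDet q s * e₂ + q.2 * hk + i * this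
    have hs0 : 0 < s.1 ^ 2 + s.2 ^ 2 := by
      by_contra! hle
      have h₁ : s.1 = 0 := by nlinarith [sq_nonneg s.1, sq_nonneg s.2]
      have h₂ : s.2 = 0 := by nlinarith [sq_nonneg s.1, sq_nonneg s.2]
      simp [planeDet, h₁, h₂] at hsp
    have hprod := mul_pos hi0 hs0
    refine (pos_iff_neg_of_mul_neg (b := r.1 * s.1 + r.2 * s.2) ?_).mp hqs
    have : planeDet q s * (r.1 * s.1 + r.2 * s.2) = -(i * (s.1 ^ 2 + s.2 ^ 2)) := by
      linear_combination s.1 * f₁ + s.2 * f₂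
    linarith
  · have hj0 : 0 < j := by
      by_contra! hle
      have : j = 0 := le_antisymm hle hj
      have h₁ := mul_pos hd0 hgt
      have h₂ := mul_nonneg hi hsp.le
      rw [hrs, this] at h₁
      linarith
    have hbound : planeDet r s < planeDet q s := by
      refine lt_of_mul_lt_mul_left ?_ hd0.le
      have h₁ := mul_lt_mul_of_pos_right hjd hqs
      have h₂ := mul_nonneg hi hsp.le
      linarith
    exact Or.inr ⟨p, hp, r, hr, s, hs, by linarith, hgt, hsp, by linarith⟩

/-- Some two points of `L` are antiparallel, or some three points of `L` are the vertices of a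
triangle with the origin in its interior. -/
theorem exists_antiparallel_or_triangle (h : IsQuasiSmoothPointSet L) :
    (∃ a ∈ L, ∃ b ∈ L, planeDet a b = 0 ∧ a.1 * b.1 + a.2 * b.2 < 0) ∨
    ∃ a ∈ L, ∃ b ∈ L, ∃ c ∈ L, 0 < planeDet a b ∧ 0 < planeDet b c ∧ 0 < planeDet c a := by
  obtain ⟨p, hp, hp1⟩ := h.exists_pos 1 0 (by simp)
  have hp0 : 0 < p.1 := by simpa using hp1
  obtain ⟨z, hz, hz0⟩ := h.exists_pos (-p.2) p.1 (Or.inr hp0.ne')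
  -- Among the points to the left of `p`, the point `q` makes the largest angle with `p`.
  obtain ⟨q, ⟨hq, hq0⟩, hqmin⟩ := Set.exists_min_image {z | z ∈ L ∧ 0 < planeDet p z}
    (fun z => ((p.1 * z.1 + p.2 * z.2 : ℤ) : ℚ) / (planeDet p z : ℤ))
    (h.finite.subset fun z hz => hz.1) ⟨z, hz, by unfold planeDet; linarith⟩
  obtain ⟨s, hs, hs0⟩ := h.exists_pos (-q.2) q.1 (by
    by_contra! hcon
    have h₁ : q.2 = 0 := by linarith [hcon.1]
    simp [planeDet, h₁, hcon.2] at hq0)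
  have hqs : 0 < planeDet q s := by unfold planeDet; linarith
  have hps : planeDet p s ≤ 0 := by
    by_contra! hlt
    have hle := hqmin s ⟨hs, hlt⟩
    have c₁ : (0 : ℚ) < (planeDet p q : ℤ) := by exact_mod_cast hq0
    have c₂ : (0 : ℚ) < (planeDet p s : ℤ) := by exact_mod_cast hlt
    rw [div_le_div_iff₀ c₁ c₂] at hle
    have hle' : (p.1 * q.1 + p.2 * q.2) * planeDet p s ≤ (p.1 * s.1 + p.2 * s.2) * planeDet p q := by
      exact_mod_cast hle
    have : (p.1 * q.1 + p.2 * q.2) * planeDet p s - (p.1 * s.1 + p.2 * s.2) * planeDet p q =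
        (p.1 ^ 2 + p.2 ^ 2) * planeDet q s := by unfold planeDet; ring
    have : 0 < (p.1 ^ 2 + p.2 ^ 2) * planeDet q s := by positivity
    linarith
  have hsp : planeDet s p = -planeDet p s := by unfold planeDet; ring
  rcases hps.lt_or_eq with hlt | heq
  · exact Or.inr ⟨p, hp, q, hq, s, hs, hq0, hqs, by linarith⟩
  · refine Or.inl ⟨p, hp, s, hs, heq, ?_⟩
    have key : planeDet p q * (p.1 * s.1 + p.2 * s.2) = -((p.1 ^ 2 + p.2 ^ 2) * planeDet q s) := by
      have : (p.1 * q.1 + p.2 * q.2) * planeDet p s - (p.1 * s.1 + p.2 * s.2) * planeDet p q =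
        (p.1 ^ 2 + p.2 ^ 2) * planeDet q s := by unfold planeDet; ring
      rw [heq] at this
      linarith
    refine (pos_iff_neg_of_mul_neg (a := planeDet p q) ?_).mp hq0
    have : 0 < (p.1 ^ 2 + p.2 ^ 2) * planeDet q s := by positivity
    linarith

/-- Shrinking a triangle around the origin as long as possible leaves two antiparallel points, or
a triangle whose three vertices are pairwise unimodular, and so add up to zero. -/
theorem exists_antiparallel_or_of_triangle (h : IsQuasiSmoothPointSet L) (n : ℕ) :
    ∀ {p q s : ℤ × ℤ}, p ∈ L → q ∈ L → s ∈ L → 0 < planeDet p q → 0 < planeDet q s →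
      0 < planeDet s p → planeDet p q + planeDet q s + planeDet s p ≤ n →
    (∃ a ∈ L, ∃ b ∈ L, planeDet a b = 0 ∧ a.1 * b.1 + a.2 * b.2 < 0) ∨
    ∃ a ∈ L, ∃ b ∈ L, planeDet a b = 1 ∧ -(a + b) ∈ L := by
  induction n with
  | zero => intro p q s _ _ _ h₁ h₂ h₃ hle; push_cast at hle; linarith
  | succ n ih =>
    intro p q s hp hq hs h₁ h₂ h₃ hle
    push_cast at hle
    have step : ∀ {a b c : ℤ × ℤ}, a ∈ L → b ∈ L → c ∈ L → 1 < planeDet a b → 0 < planeDet b c →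
        0 < planeDet c a → planeDet a b + planeDet b c + planeDet c a ≤ n + 1 →
        (∃ a ∈ L, ∃ b ∈ L, planeDet a b = 0 ∧ a.1 * b.1 + a.2 * b.2 < 0) ∨
        ∃ a ∈ L, ∃ b ∈ L, planeDet a b = 1 ∧ -(a + b) ∈ L := by
      intro a b c ha hb hc g₁ g₂ g₃ g
      rcases h.exists_smaller_triangle ha hb hc g₁ g₂ g₃ with
        hpair | ⟨a', ha', b', hb', c', hc', k₁, k₂, k₃, k⟩
      · exact Or.inl hpair
      · exact ih ha' hb' hc' k₁ k₂ k₃ (by linarith)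
    rcases lt_or_ge 1 (planeDet p q) with g₁ | g₁
    · exact step hp hq hs g₁ h₂ h₃ hle
    rcases lt_or_ge 1 (planeDet q s) with g₂ | g₂
    · exact step hq hs hp g₂ h₃ h₁ (by linarith)
    rcases lt_or_ge 1 (planeDet s p) with g₃ | g₃
    · exact step hs hp hq g₃ h₁ h₂ (by linarith)
    have k₁ : planeDet p q = 1 := by linarith
    have k₂ : planeDet q s = 1 := by linarith
    have k₃ : planeDet s p = 1 := by linarith
    refine Or.inr ⟨p, hp, q, hq, k₁, ?_⟩
    have : -(p + q) = s := by
      unfold planeDet at *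
      ext
      · simp only [Prod.fst_neg, Prod.fst_add]
        linear_combination p.1 * k₂ + q.1 * k₃ + s.1 * k₁
      · simp only [Prod.snd_neg, Prod.snd_add]
        linear_combination p.2 * k₂ + q.2 * k₃ + s.2 * k₁
    rwa [this]

/-- A triangle `p`, `q`, `-(p + q)` of unimodular vectors does not occur alone: by the row inequality
in the basis `p`, `q`, one of `p + q` and `-q` lies in `L`. -/
theorem exists_antiparallel (h : IsQuasiSmoothPointSet L) :
    ∃ a ∈ L, ∃ b ∈ L, planeDet a b = 0 ∧ a.1 * b.1 + a.2 * b.2 < 0 := by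
  rcases h.exists_antiparallel_or_triangle with hpair | ⟨p, hp, q, hq, s, hs, h₁, h₂, h₃⟩
  · exact hpair
  rcases h.exists_antiparallel_or_of_triangle (planeDet p q + planeDet q s + planeDet s p).toNat
    hp hq hs h₁ h₂ h₃ (Int.self_le_toNat _) with hpair | ⟨p, hp, q, hq, hdet, hs⟩
  · exact hpair
  have hL := h.inBasis hdet
  have hp' : (1, 0) ∈ coordSet L p q := by simpa [coordSet] using hp
  have hq' : (0, 1) ∈ coordSet L p q := by simpa [coordSet] using hq
  have hs' : (-1, -1) ∈ coordSet L p q := by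
    have : (-1 * p.1 + -1 * q.1, -1 * p.2 + -1 * q.2) = -(p + q) := by
      ext
      · simp only [Prod.fst_neg, Prod.fst_add]; ring
      · simp only [Prod.snd_neg, Prod.snd_add]; ring
    rw [coordSet, Set.mem_ofPred_eq, this]
    exact hs
  obtain ⟨b, B, hb, hB, hbB⟩ := hL.exists_add_nonneg hp' hq' hs'
  rcases lt_or_ge 0 b with hb0 | hb0
  · -- The point `p + q` lies in `L` together with `-(p + q)`.
    have hmem : (1, 1) ∈ coordSet L p q := hL.mem_row_of_le hq' hb (by norm_num) (by linarith)
    have hmem' : p + q ∈ L := by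
      simpa [coordSet, Prod.add_def] using hmem
    refine ⟨p + q, hmem', _, hs, by simp [planeDet]; ring, ?_⟩
    have : 0 < (p + q).1 ^ 2 + (p + q).2 ^ 2 := by
      by_contra! hle
      have e₁ : (p + q).1 = 0 := by nlinarith [sq_nonneg (p + q).1, sq_nonneg (p + q).2]
      have e₂ : (p + q).2 = 0 := by nlinarith [sq_nonneg (p + q).1, sq_nonneg (p + q).2]
      have : planeDet p q = p.1 * (p + q).2 - p.2 * (p + q).1 := by
        simp only [planeDet, Prod.fst_add, Prod.snd_add]; ring
      rw [e₁, e₂] at this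
      linarith
    simp only [Prod.fst_neg, Prod.snd_neg]
    linarith
  · -- The point `q` lies in `L` together with `-q`.
    have hmem : (0, -1) ∈ coordSet L p q :=
      hL.mem_row_of_le hs' hB (by norm_num) (by linarith)
    have hmem' : -q ∈ L := by
      have : (-q.1, -q.2) ∈ L := by simpa [coordSet] using hmem
      exact this
    refine ⟨q, hq, _, hmem', by simp [planeDet]; ring, ?_⟩
    have : 0 < q.1 ^ 2 + q.2 ^ 2 := by
      by_contra! hle
      have e₁ : q.1 = 0 := by nlinarith [sq_nonneg q.1, sq_nonneg q.2]
      have e₂ : q.2 = 0 := by nlinarith [sq_nonneg q.1, sq_nonneg q.2]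
      simp [planeDet, e₁, e₂] at hdet
    simp only [Prod.fst_neg, Prod.snd_neg]
    linarith

theorem exists_unimodular (h : IsQuasiSmoothPointSet L) :
    ∃ r s, r ∈ L ∧ -r ∈ L ∧ s ∈ L ∧ -s ∈ L ∧ planeDet r s = 1 := by
  obtain ⟨a, ha, b, hb, hdet, hdot⟩ := h.exists_antiparallel
  exact h.exists_unimodular_of_antiparallel ha hb hdet hdot

end IsQuasiSmoothPointSet

/-! ### The lattice points of a quasi-smooth polygon -/

/-- The lattice points of `P`, as pairs of integers. -/
def latticePoints (P : Set (Fin 2 → ℝ)) : Set (ℤ × ℤ) := {z | intPoint ![z.1, z.2] ∈ P}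

theorem exists_intPoint_eq {x : Fin 2 → ℝ} (hx : x ∈ integerLattice 2) :
    ∃ z : ℤ × ℤ, intPoint ![z.1, z.2] = x := by
  obtain ⟨w, rfl⟩ := hx
  refine ⟨(w 0, w 1), ?_⟩
  ext i
  fin_cases i <;> rfl

theorem latticePoints_finite {P : Set (Fin 2 → ℝ)} (hP : Bornology.IsBounded P) :
    (latticePoints P).Finite := by
  obtain ⟨M, hM⟩ := hP.exists_norm_le
  refine (Set.finite_Icc ((-⌈M⌉, -⌈M⌉) : ℤ × ℤ) (⌈M⌉, ⌈M⌉)).subset fun z hz => ?_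
  have hn := (pi_norm_le_iff_of_nonneg ((norm_nonneg _).trans (hM _ hz))).mp (hM _ hz)
  have h₀ := (hn 0).trans (Int.le_ceil M)
  have h₁ := (hn 1).trans (Int.le_ceil M)
  simp only [intPoint, Matrix.cons_val_zero, Matrix.cons_val_one, Real.norm_eq_abs] at h₀ h₁
  have h₀' : |z.1| ≤ ⌈M⌉ := by exact_mod_cast h₀
  have h₁' : |z.2| ≤ ⌈M⌉ := by exact_mod_cast h₁
  exact ⟨⟨(abs_le.mp h₀').1, (abs_le.mp h₁').1⟩, ⟨(abs_le.mp h₀').2, (abs_le.mp h₁').2⟩⟩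

theorem Convex.mem_latticePoints {P : Set (Fin 2 → ℝ)} (hP : Convex ℝ P) {p q r z : ℤ × ℤ}
    (i j k : ℤ) (hp : p ∈ latticePoints P) (hq : q ∈ latticePoints P) (hr : r ∈ latticePoints P)
    (hi : 0 ≤ i) (hj : 0 ≤ j) (hk : 0 ≤ k) (hs : 0 < i + j + k)
    (h₁ : (i + j + k) * z.1 = i * p.1 + j * q.1 + k * r.1)
    (h₂ : (i + j + k) * z.2 = i * p.2 + j * q.2 + k * r.2) : z ∈ latticePoints P := by
  have hi' : (0 : ℝ) ≤ i := by exact_mod_cast hi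
  have hj' : (0 : ℝ) ≤ j := by exact_mod_cast hj
  have hk' : (0 : ℝ) ≤ k := by exact_mod_cast hk
  have hs' : (0 : ℝ) < i + j + k := by exact_mod_cast hs
  have e₁ : ((i : ℝ) + j + k) * z.1 = i * p.1 + j * q.1 + k * r.1 := by exact_mod_cast h₁
  have e₂ : ((i : ℝ) + j + k) * z.2 = i * p.2 + j * q.2 + k * r.2 := by exact_mod_cast h₂
  have hmem := hP.sum_mem (t := Finset.univ)
    (w := ![(i : ℝ) / (i + j + k), j / (i + j + k), k / (i + j + k)])
    (z := ![intPoint ![p.1, p.2], intPoint ![q.1, q.2], intPoint ![r.1, r.2]])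
    (by intro a _; fin_cases a <;> simp <;> positivity)
    (by simp only [Fin.sum_univ_three, Matrix.cons_val]; field_simp)
    (by intro a _; fin_cases a <;> assumption)
  show intPoint ![z.1, z.2] ∈ P
  convert hmem using 1
  simp only [Fin.sum_univ_three, Matrix.cons_val]
  ext a
  fin_cases a
  · simp [intPoint]
    field_simp
    linarith
  · simp [intPoint]
    field_simp
    linarith

/-- A linear functional that is nonpositive on the lattice points of a lattice polygon is
nonpositive on the polygon, hence zero if the origin is an interior point. -/
theorem exists_latticePoint_pos {S : Set (Fin 2 → ℝ)} (hS : S ⊆ integerLattice 2)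
    (h0 : (0 : Fin 2 → ℝ) ∈ interior (convexHull ℝ S)) (a b : ℤ) (hab : a ≠ 0 ∨ b ≠ 0) :
    ∃ z ∈ latticePoints (convexHull ℝ S), 0 < a * z.1 + b * z.2 := by
  by_contra! hcon
  have hsub : convexHull ℝ S ⊆ {x | (a : ℝ) * x 0 + b * x 1 ≤ 0} := by
    refine convexHull_min (fun x hx => ?_) ?_
    · obtain ⟨z, rfl⟩ := exists_intPoint_eq (hS hx)
      have := hcon z (subset_convexHull ℝ S hx)
      simp only [intPoint, Set.mem_ofPred_eq, Matrix.cons_val_zero, Matrix.cons_val_one]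
      exact_mod_cast this
    · refine convex_halfSpace_le ⟨?_, ?_⟩ 0
      · intro x y; simp; ring
      · intro c x; simp; ring
  have hnhds : ∀ᶠ t : ℝ in nhds 0, (fun t : ℝ => (![t * a, t * b] : Fin 2 → ℝ)) t ∈
      interior (convexHull ℝ S) := by
    have hc : Continuous (fun t : ℝ => (![t * a, t * b] : Fin 2 → ℝ)) := by
      refine continuous_pi fun i => ?_
      fin_cases i
      · exact continuous_id.mul continuous_const
      · exact continuous_id.mul continuous_const
    refine hc.continuousAt.eventually_mem (isOpen_interior.mem_nhds ?_)
    convert h0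
    ext i
    fin_cases i <;> simp
  obtain ⟨ε, hε, hball⟩ := Metric.eventually_nhds_iff.mp hnhds
  have hmem := hsub (interior_subset (hball (y := ε / 2) (by
    rw [dist_zero_right, Real.norm_eq_abs, abs_of_pos (by linarith)]; linarith)))
  simp only [Set.mem_ofPred_eq, Matrix.cons_val_zero, Matrix.cons_val_one] at hmem
  have hpos : (0 : ℝ) < a ^ 2 + b ^ 2 := by
    rcases hab with h | h
    · have : (a : ℝ) ≠ 0 := by exact_mod_cast h
      positivity
    · have : (b : ℝ) ≠ 0 := by exact_mod_cast h
      positivity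
  nlinarith

/-- A lattice point where a linear functional has its strict maximum over the lattice points is a
vertex, because `v` together with the open half-plane below it is convex. -/
theorem mem_extremePoints_of_strict_max {S : Set (Fin 2 → ℝ)} (hS : S ⊆ integerLattice 2)
    (a b : ℤ) {v : ℤ × ℤ} (hv : v ∈ latticePoints (convexHull ℝ S))
    (hmax : ∀ z ∈ latticePoints (convexHull ℝ S), z ≠ v →
      a * z.1 + b * z.2 < a * v.1 + b * v.2) :
    intPoint ![v.1, v.2] ∈ (convexHull ℝ S).extremePoints ℝ := by
  set w := intPoint ![v.1, v.2] with hw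
  set φ : (Fin 2 → ℝ) → ℝ := fun x => (a : ℝ) * x 0 + b * x 1 with hφ
  have hφ_comb : ∀ (s t : ℝ) x y, φ (s • x + t • y) = s * φ x + t * φ y := by
    intro s t x y
    simp [hφ]
    ring
  have hsub : convexHull ℝ S ⊆ {x | x = w ∨ φ x < φ w} := by
    refine convexHull_min (fun x hx => ?_) ?_
    · obtain ⟨z, rfl⟩ := exists_intPoint_eq (hS hx)
      by_cases hzv : z = v
      · left; rw [hzv]
      · right
        have := hmax z (subset_convexHull ℝ S hx) hzv
        simp only [hφ, hw, intPoint, Matrix.cons_val_zero, Matrix.cons_val_one]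
        exact_mod_cast this
    · intro x hx y hy s t hs ht hst
      rcases hs.eq_or_lt with rfl | hs
      · have : t = 1 := by linarith
        simpa [this] using hy
      rcases ht.eq_or_lt with rfl | ht
      · have : s = 1 := by linarith
        simpa [this] using hx
      have hle : ∀ {x}, x = w ∨ φ x < φ w → φ x ≤ φ w := by
        rintro x (rfl | h)
        · exact le_rfl
        · exact h.le
      have hw1 : φ w = s * φ w + t * φ w := by rw [← add_mul, hst, one_mul]
      rcases hx with rfl | hx
      · rcases hy with rfl | hy
        · left; rw [← add_smul, hst, one_smul]
        · right
          rw [hφ_comb]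
          have := mul_lt_mul_of_pos_left hy ht
          linarith
      · right
        rw [hφ_comb]
        have h₁ := mul_lt_mul_of_pos_left hx hs
        have h₂ := mul_le_mul_of_nonneg_left (hle hy) ht.le
        linarith
  refine ⟨hv, fun x hx y hy hxy => ?_⟩
  obtain ⟨s, t, hs, ht, hst, hxyw⟩ := hxy
  have hw1 : φ w = s * φ w + t * φ w := by rw [← add_mul, hst, one_mul]
  have hcomb := hφ_comb s t x y
  rw [hxyw] at hcomb
  rcases hsub hx with hx | hx
  · exact hx
  · exfalso
    have h₁ := mul_lt_mul_of_pos_left hx hs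
    have h₂ : φ y ≤ φ w := by
      rcases hsub hy with rfl | h
      · exact le_rfl
      · exact h.le
    have h₃ := mul_le_mul_of_nonneg_left h₂ ht.le
    linarith

/-- A convex body lies on one side of the line spanned by a segment in its frontier. -/
theorem exists_side_of_segment_subset_frontier {P : Set (Fin 2 → ℝ)} (hP : Convex ℝ P)
    (hint : (interior P).Nonempty) {v w : Fin 2 → ℝ} (hwv : w ≠ v) (hv : v ∈ P) (hw : w ∈ P)
    (hseg : segment ℝ v w ⊆ frontier P) :
    ∃ c : ℝ, c ≠ 0 ∧ ∀ x ∈ P,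
      0 ≤ c * ((w 0 - v 0) * (x 1 - v 1) - (w 1 - v 1) * (x 0 - v 0)) := by
  have hm : midpoint ℝ v w ∈ frontier P := hseg (midpoint_mem_segment v w)
  obtain ⟨f, hf⟩ := geometric_hahn_banach_open_point hP.interior isOpen_interior hm.2
  have hle : ∀ x ∈ P, f x ≤ f (midpoint ℝ v w) := by
    intro x hx
    have hx' : x ∈ closure (interior P) := by
      rw [hP.closure_interior_eq_closure_of_nonempty_interior hint]
      exact subset_closure hx
    exact closure_minimal (fun y hy => (hf y hy).le)
      (isClosed_le f.continuous continuous_const) hx'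
  have hmid : f (midpoint ℝ v w) = (f v + f w) / 2 := by
    rw [midpoint_eq_smul_add, map_smul, map_add]
    simp
    ring
  have hfv := hle v hv
  have hfw := hle w hw
  have hfvw : f w = f v := by linarith
  have hrepr : ∀ x, f x = f (Pi.single 0 1) * x 0 + f (Pi.single 1 1) * x 1 := by
    intro x
    have : x = x 0 • (Pi.single 0 1 : Fin 2 → ℝ) + x 1 • (Pi.single 1 1 : Fin 2 → ℝ) := by
      ext i
      fin_cases i <;> simp
    conv_lhs => rw [this, map_add, map_smul, map_smul]
    simp
    ring
  set a := f (Pi.single 0 1)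
  set b := f (Pi.single 1 1)
  have he : a * (w 0 - v 0) + b * (w 1 - v 1) = 0 := by
    have h₁ := hrepr w
    have h₂ := hrepr v
    linarith
  have hab : ∀ x ∈ P, a * (x 0 - v 0) + b * (x 1 - v 1) ≤ 0 := by
    intro x hx
    have h₁ := hrepr x
    have h₂ := hrepr v
    have := hle x hx
    linarith
  obtain ⟨y, hy⟩ := hint
  have hy' : a * (y 0 - v 0) + b * (y 1 - v 1) < 0 := by
    have h₁ := hrepr y
    have h₂ := hrepr v
    have := hf y hy
    linarith
  have hpos : 0 < (w 0 - v 0) ^ 2 + (w 1 - v 1) ^ 2 := by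
    by_contra! hle
    apply hwv
    ext i
    fin_cases i
    · show w 0 = v 0
      nlinarith [sq_nonneg (w 0 - v 0), sq_nonneg (w 1 - v 1)]
    · show w 1 = v 1
      nlinarith [sq_nonneg (w 0 - v 0), sq_nonneg (w 1 - v 1)]
  -- The supporting functional `(a, b)` is proportional to `det(w - v, ·)`.
  have key : ∀ x : Fin 2 → ℝ, (a * (w 1 - v 1) - b * (w 0 - v 0)) *
      ((w 0 - v 0) * (x 1 - v 1) - (w 1 - v 1) * (x 0 - v 0)) =
      -((w 0 - v 0) ^ 2 + (w 1 - v 1) ^ 2) * (a * (x 0 - v 0) + b * (x 1 - v 1)) := by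
    intro x
    linear_combination ((w 1 - v 1) * (x 1 - v 1) + (w 0 - v 0) * (x 0 - v 0)) * he
  refine ⟨a * (w 1 - v 1) - b * (w 0 - v 0), ?_, fun x hx => ?_⟩
  · intro h0
    have := key y
    rw [h0, zero_mul] at this
    have := mul_neg_of_pos_of_neg hpos hy'
    linarith
  · rw [key]
    have := mul_nonneg hpos.le (neg_nonneg.mpr (hab x hx))
    linarith

/-- An edge of a lattice polygon, in integer terms: all lattice points of `P` lie on one side of the
line through `v` and the next lattice point `w = v + e` along the boundary. -/
theorem IsNextAlongBoundary.exists_edge {P : Set (Fin 2 → ℝ)} (hP : Convex ℝ P)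
    (hclosed : IsClosed P) (hint : (interior P).Nonempty) {v : ℤ × ℤ} {w : Fin 2 → ℝ}
    (h : IsNextAlongBoundary P (intPoint ![v.1, v.2]) w) :
    ∃ e : ℤ × ℤ, w = intPoint ![v.1 + e.1, v.2 + e.2] ∧ v + e ∈ latticePoints P ∧
      ((∀ z ∈ latticePoints P, 0 ≤ planeDet e (z - v)) ∨
        ∀ z ∈ latticePoints P, planeDet e (z - v) ≤ 0) := by
  obtain ⟨-, hw, hne, hseg, -⟩ := h
  obtain ⟨z, rfl⟩ := exists_intPoint_eq hw
  have hfr : frontier P ⊆ P := hclosed.frontier_subset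
  have hv := hfr (hseg (left_mem_segment ℝ _ _))
  have hz := hfr (hseg (right_mem_segment ℝ _ _))
  obtain ⟨c, hc, hside⟩ := exists_side_of_segment_subset_frontier hP hint hne hv hz hseg
  have hcast : ∀ x ∈ latticePoints P, 0 ≤ c * ((planeDet (z - v) (x - v) : ℤ) : ℝ) := by
    intro x hx
    have := hside _ hx
    simp only [intPoint, Matrix.cons_val_zero, Matrix.cons_val_one] at this
    simp only [planeDet, Prod.fst_sub, Prod.snd_sub]
    push_cast
    exact this
  refine ⟨z - v, by simp, by rw [add_sub_cancel]; exact hz, ?_⟩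
  rcases hc.lt_or_gt with hc | hc
  · right
    intro x hx
    have : ((planeDet (z - v) (x - v) : ℤ) : ℝ) ≤ 0 := by
      by_contra! hlt
      linarith [hcast x hx, mul_neg_of_neg_of_pos hc hlt]
    exact_mod_cast this
  · left
    intro x hx
    have : (0 : ℝ) ≤ ((planeDet (z - v) (x - v) : ℤ) : ℝ) :=
      nonneg_of_mul_nonneg_right (hcast x hx) hc
    exact_mod_cast this

/-- Quasi-smoothness at a vertex `v`, in integer terms: the polygon lies in the cone at `v` between
two edge vectors `e` and `e'`, and an integer functional takes the value `1` on both. -/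
theorem IsQuasiSmoothAt.exists_cone {P : Set (Fin 2 → ℝ)} (hP : Convex ℝ P)
    (hclosed : IsClosed P) (hint : (interior P).Nonempty) {v : ℤ × ℤ}
    (h : IsQuasiSmoothAt P (intPoint ![v.1, v.2])) :
    ∃ e e' u : ℤ × ℤ, v + e ∈ latticePoints P ∧ v + e' ∈ latticePoints P ∧
      u.1 * e.1 + u.2 * e.2 = 1 ∧ u.1 * e'.1 + u.2 * e'.2 = 1 ∧
      ∀ z ∈ latticePoints P, 0 ≤ planeDet e (z - v) ∧ 0 ≤ planeDet (z - v) e' := by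
  obtain ⟨w₁, w₂, hne, hw₁, hw₂, u, b, -, hline, hdist⟩ := h
  obtain ⟨e, rfl, he, hside⟩ := hw₁.exists_edge hP hclosed hint
  obtain ⟨e', rfl, he', hside'⟩ := hw₂.exists_edge hP hclosed hint
  have hb₁ : intPoint ![v.1 + e.1, v.2 + e.2] ∈ {x | intPoint u ⬝ᵥ x = b} := by
    rw [← hline]; exact left_mem_affineSpan_pair ℝ _ _
  have hb₂ : intPoint ![v.1 + e'.1, v.2 + e'.2] ∈ {x | intPoint u ⬝ᵥ x = b} := by
    rw [← hline]; exact right_mem_affineSpan_pair ℝ _ _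
  simp only [Set.mem_ofPred_eq, dotProduct, Fin.sum_univ_two, intPoint, Matrix.cons_val_zero,
    Matrix.cons_val_one] at hb₁ hb₂ hdist
  -- After a change of sign, the functional `u` takes the value `1` on both edge vectors.
  obtain ⟨u', hu, hu'⟩ : ∃ u' : ℤ × ℤ, u'.1 * e.1 + u'.2 * e.2 = 1 ∧
      u'.1 * e'.1 + u'.2 * e'.2 = 1 := by
    push_cast at hb₁ hb₂
    rcases (abs_eq zero_le_one).mp hdist with h | h
    · refine ⟨(u 0, u 1), ?_, ?_⟩
      · have : (u 0 : ℝ) * e.1 + u 1 * e.2 = 1 := by linarith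
        exact_mod_cast this
      · have : (u 0 : ℝ) * e'.1 + u 1 * e'.2 = 1 := by linarith
        exact_mod_cast this
    · refine ⟨(-u 0, -u 1), ?_, ?_⟩
      · have : -(u 0 : ℝ) * e.1 + -u 1 * e.2 = 1 := by linarith
        exact_mod_cast this
      · have : -(u 0 : ℝ) * e'.1 + -u 1 * e'.2 = 1 := by linarith
        exact_mod_cast this
  have hdet : planeDet e e' ≠ 0 := by
    intro h0
    apply hne
    unfold planeDet at h0
    have h₁ : e.1 = e'.1 := by linear_combination e'.1 * hu - e.1 * hu' + u'.2 * h0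
    have h₂ : e.2 = e'.2 := by linear_combination e'.2 * hu - e.2 * hu' - u'.1 * h0
    rw [h₁, h₂]
  have hswap : ∀ a c : ℤ × ℤ, planeDet a c = -planeDet c a := fun a c => by
    unfold planeDet; ring
  have hs₁ : (∀ z ∈ latticePoints P, 0 ≤ planeDet e (z - v)) ∧ 0 < planeDet e e' ∨
      (∀ z ∈ latticePoints P, planeDet e (z - v) ≤ 0) ∧ planeDet e e' < 0 := by
    rcases hside with hs | hs
    · have := hs _ he'
      rw [add_sub_cancel_left] at this
      exact Or.inl ⟨hs, lt_of_le_of_ne this hdet.symm⟩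
    · have := hs _ he'
      rw [add_sub_cancel_left] at this
      exact Or.inr ⟨hs, lt_of_le_of_ne this hdet⟩
  have hs₂ : (∀ z ∈ latticePoints P, 0 ≤ planeDet e' (z - v)) ∧ planeDet e e' < 0 ∨
      (∀ z ∈ latticePoints P, planeDet e' (z - v) ≤ 0) ∧ 0 < planeDet e e' := by
    rw [hswap e e'] at hdet ⊢
    rcases hside' with hs | hs
    · have := hs _ he
      rw [add_sub_cancel_left] at this
      exact Or.inl ⟨hs, neg_neg_of_pos (lt_of_le_of_ne this (neg_ne_zero.mp hdet).symm)⟩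
    · have := hs _ he
      rw [add_sub_cancel_left] at this
      exact Or.inr ⟨hs, neg_pos_of_neg (lt_of_le_of_ne this (neg_ne_zero.mp hdet))⟩
  rcases hs₁ with ⟨hs₁, hpos⟩ | ⟨hs₁, hneg⟩
  · rcases hs₂ with ⟨-, hneg⟩ | ⟨hs₂, -⟩
    · exact absurd hpos hneg.not_gt
    · refine ⟨e, e', u', he, he', hu, hu', fun z hz => ⟨hs₁ z hz, ?_⟩⟩
      rw [hswap]
      exact neg_nonneg.mpr (hs₂ z hz)
  · rcases hs₂ with ⟨hs₂, -⟩ | ⟨-, hpos⟩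
    · refine ⟨e', e, u', he', he, hu', hu, fun z hz => ⟨hs₂ z hz, ?_⟩⟩
      rw [hswap]
      exact neg_nonneg.mpr (hs₁ z hz)
    · exact absurd hpos hneg.not_gt

theorem IsQuasiSmooth.isQuasiSmoothPointSet {P : Set (Fin 2 → ℝ)} (hP : IsLatticePolygon P)
    (hqs : IsQuasiSmooth P) (h0 : (0 : Fin 2 → ℝ) ∈ interior P) :
    IsQuasiSmoothPointSet (latticePoints P) := by
  obtain ⟨⟨S, hfin, hS, rfl⟩, hint⟩ := hP
  have hcompact : IsCompact (convexHull ℝ S) := hfin.isCompact_convexHull ℝ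
  exact
    { finite := latticePoints_finite hcompact.isBounded
      zero_mem := by
        have : intPoint ![0, 0] = (0 : Fin 2 → ℝ) := by
          ext i; fin_cases i <;> simp [intPoint]
        show intPoint ![0, 0] ∈ convexHull ℝ S
        rw [this]
        exact interior_subset h0
      convex := (convex_convexHull ℝ S).mem_latticePoints
      exists_pos := exists_latticePoint_pos hS h0
      vertex := fun a b v hv hmax =>
        (hqs _ (mem_extremePoints_of_strict_max hS a b hv hmax)).exists_cone
          (convex_convexHull ℝ S) hcompact.isClosed hint }

/-! ### The Ewald set -/

theorem exists_basis_of_planeDet_eq_one {r s : ℤ × ℤ} (h : planeDet r s = 1) :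
    ∃ b : Module.Basis (Fin 2) ℤ (Fin 2 → ℤ), b 0 = ![r.1, r.2] ∧ b 1 = ![s.1, s.2] := by
  have hunit : IsUnit ((Pi.basisFun ℤ (Fin 2)).det ![![r.1, r.2], ![s.1, s.2]]) := by
    rw [Pi.basisFun_det_apply, Matrix.det_fin_two]
    simp only [Matrix.of_apply, Matrix.cons_val_zero, Matrix.cons_val_one]
    unfold planeDet at h
    rw [h]
    exact isUnit_one
  obtain ⟨hli, hspan⟩ := (Module.Basis.is_basis_iff_det _).mpr hunit
  exact ⟨Module.Basis.mk hli hspan.ge, by simp, by simp⟩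

theorem corollary7 (P : Set (Fin 2 → ℝ)) (hP : IsLatticePolygon P) (hqs : IsQuasiSmooth P)
    (h0 : (0 : Fin 2 → ℝ) ∈ interior P) :
    ∃ b : Module.Basis (Fin 2) ℤ (Fin 2 → ℤ), ∀ i, intPoint (b i) ∈ ewaldSet P := by
  obtain ⟨r, s, hr, hr', hs, hs', hdet⟩ := (hqs.isQuasiSmoothPointSet hP h0).exists_unimodular
  obtain ⟨b, hb₀, hb₁⟩ := exists_basis_of_planeDet_eq_one hdet
  have hneg : ∀ z : ℤ × ℤ, -z ∈ latticePoints P → -intPoint ![z.1, z.2] ∈ P := by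
    intro z hz
    have : -intPoint ![z.1, z.2] = intPoint ![(-z).1, (-z).2] := by
      ext i; fin_cases i <;> simp [intPoint]
    rw [this]
    exact hz
  refine ⟨b, fun i => ?_⟩
  fin_cases i
  · show intPoint (b 0) ∈ _
    rw [hb₀]
    exact ⟨⟨_, rfl⟩, hr, hneg r hr'⟩
  · show intPoint (b 1) ∈ _
    rw [hb₁]
    exact ⟨⟨_, rfl⟩, hs, hneg s hs'⟩
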